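/- Let $A=(a_{ij})_{i,j\in I}$ be an indecomposable Cartan matrix of finite type, i.e. $a_{ij}=\langle\alpha_j,\alpha_i^\vee\rangle$ for a base $\{\alpha_i\}_{i\in I}$ of a finite, reduced, irreducible, crystallographic root system, with Weyl group $W$ and simple reflections $s_i$, so that $s_i\alpha_j=\alpha_j-a_{ij}\alpha_i$. Let $(d_i)_{i\in I}$ be positive integers such that $d_ia_{ij}=d_ja_{ji}$ for all $i,j$, normalised so that $d_j=1$ whenever $a_{ji}\le -2$ for some $i$ (which is automatic if the $d_i$ have no common divisor). Let $q\in\mathbb C^\times$ not be a root of unity, and put $q_i=q^{d_i}$. Let $\mathcal P^+$ be the monoid, under coordinatewise multiplication, of $I$-tuples of polynomials in $\mathbb C[u]$ with constant term $1$, and let $\mathcal P\supset\mathcal P^+$ be the group it generates inside the $I$-tuples of non-zero rational functions in $u$. For $i\in I$ and $a\in\mathbb C^\times$ let $\pi_{i,a}\in\mathcal P^+$ have $i$-th coordinate $1-au$ and all other coordinates $1$. For $i\in I$ let $\tilde T_i:\mathcal P\to\mathcal P$ be the group homomorphism given, for $\varpi=(\varpi_j)_{j\in I}$, by $$(\tilde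 T_i\varpi)_i=\frac1{\varpi_i(q_i^2u)},$$ and for $j\neq i$ by $$(\tilde T_i\varpi)_j=\begin{cases}\varpi_j(u), & a_{ji}=0,\\ \varpi_j(u)\varpi_i(q_iu), & a_{ji}=-1,\\ \varpi_j(u)\varpi_i(q^3u)\varpi_i(qu), & a_{ji}=-2,\\ \varpi_j(u)\varpi_i(q^5u)\varpi_i(q^3u)\varpi_i(qu), & a_{ji}=-3.\end{cases}$$ For $w\in W$ with reduced expression $w=s_{i_1}\cdots s_{i_k}$ put $\tilde T_w=\tilde T_{i_1}\cdots\tilde T_{i_k}$ (this does not depend on the reduced expression; the assertion below is made for every reduced expression of $w$). Let $\alpha_{i,a}=(\tilde T_i\pi_{i,a})^{-1}\pi_{i,a}$, let $\mathcal Q^+$ be the submonoid of $\mathcal P$ generated by all $\alpha_{i,a}$ with $i\in I$, $a\in\mathbb C^\times$, let $\mathcal Q^-=(\mathcal Q^+)^{-1}$, and write $\varpi\preccurlyeq\varpi'$ if $\varpi\in\varpi'\mathcal Q^-$. **Corollary.** If $\pi\in\mathcal P^+$ and $w\in W$, then $\tilde T_w\pi\preccurlyeq\pi$, i.e. $\tilde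 T_w\pi\in\pi\,\mathcal Q^-$. -/

import Mathlib

/-! # The ℓ-weight lattice, the ℓ-root lattice and the braid group action -/

noncomputable section

namespace QAff

open Polynomial

section RootDatum

variable {ι k M N : Type*} [Field k] [AddCommGroup M] [Module k M]
  [AddCommGroup N] [Module k N] {R : RootPairing ι k M N}

/-- The Cartan matrix `a i j = ⟨α_j, α_i^∨⟩`, in the convention `s_i α_j = α_j - a_ij α_i`
(the transpose of Mathlib's convention). -/
def cartan [R.IsCrystallographic] (b : R.Base) : Matrix b.support b.support ℤ :=
  b.cartanMatrix.transpose

/-- The convention is as announced: `s_i α_j = α_j - a_ij α_i`. -/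
theorem reflection_simple_root [R.IsCrystallographic] (b : R.Base) (i j : b.support) :
    R.reflection i (R.root j) = R.root j - (cartan b i j) • R.root i := by
  have h : ((cartan b i j : ℤ) : k) = R.pairing j i := by
    have := b.algebraMap_cartanMatrixIn_apply ℤ j i
    simpa [cartan] using this
  rw [R.reflection_apply_root, ← h, Int.cast_smul_eq_zsmul]

/-- The product `s_{i₁} ⋯ s_{i_r}` of simple reflections in the Weyl group. -/
def simpleWord (b : R.Base) (l : List b.support) : R.weylGroup :=
  (l.map fun i => RootPairing.weylGroup.ofIdx R (i : ι)).prod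

/-- `s_{i₁} ⋯ s_{i_r}` is a reduced expression of `w`: its product is `w`, and no product of fewer
simple reflections is `w`. -/
def IsReducedExpression (b : R.Base) (l : List b.support) (w : R.weylGroup) : Prop :=
  simpleWord b l = w ∧ ∀ l' : List b.support, simpleWord b l' = w → l.length ≤ l'.length

end RootDatum

section Lattices

variable {I : Type*}

/-- The ring homomorphism `ϖ(u) ↦ ϖ(c u)` of `ℂ(u)`, for `c ≠ 0`. -/
def dilate (c : ℂˣ) : RatFunc ℂ →+* RatFunc ℂ :=
  RatFunc.mapRingHom (compRingHom (C (c : ℂ) * X)) (by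
    intro p hp
    rw [Submonoid.mem_comap, mem_nonZeroDivisors_iff_ne_zero]
    rw [mem_nonZeroDivisors_iff_ne_zero] at hp
    simpa [coe_compRingHom_apply, comp_C_mul_X_eq_zero_iff] using hp)

/-- The units of `ℂ(u)` under `ϖ(u) ↦ ϖ(c u)`. -/
def dilateUnits (c : ℂˣ) : (RatFunc ℂ)ˣ →* (RatFunc ℂ)ˣ :=
  Units.map (dilate c : RatFunc ℂ →* RatFunc ℂ)

variable (I) in
/-- `𝒫⁺`, the monoid of `I`-tuples of polynomials with constant term one, inside the group of
`I`-tuples of non-zero rational functions. -/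
def polyTuples : Submonoid (I → (RatFunc ℂ)ˣ) where
  carrier := {ϖ | ∀ i, ∃ p : ℂ[X], p.coeff 0 = 1 ∧
    ((ϖ i : (RatFunc ℂ)ˣ) : RatFunc ℂ) = algebraMap ℂ[X] (RatFunc ℂ) p}
  one_mem' := fun _ => ⟨1, by simp⟩
  mul_mem' := by
    intro x y hx hy i
    obtain ⟨p, hp, hp'⟩ := hx i
    obtain ⟨r, hr, hr'⟩ := hy i
    exact ⟨p * r, by simp [mul_coeff_zero, hp, hr], by simp [hp', hr']⟩

variable (I) in
/-- The ℓ-weight lattice `𝒫`: the group generated by `𝒫⁺`. -/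
def ellWeights : Subgroup (I → (RatFunc ℂ)ˣ) :=
  Subgroup.closure (polyTuples I : Set (I → (RatFunc ℂ)ˣ))

variable (I) in
/-- `𝒫⁺` as a submonoid of `𝒫`. -/
def dominant : Submonoid (ellWeights I) :=
  (polyTuples I).comap (ellWeights I).subtype

theorem one_sub_C_mul_X_ne_zero (a : ℂ) : algebraMap ℂ[X] (RatFunc ℂ) (1 - C a * X) ≠ 0 := by
  apply RatFunc.algebraMap_ne_zero
  intro h
  have := congrArg (fun p => coeff p 0) h
  simp at this

variable [DecidableEq I]

/-- The tuple with `i`-th coordinate `1 - a u` and all other coordinates one. -/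
def fundTuple (i : I) (a : ℂˣ) : I → (RatFunc ℂ)ˣ :=
  Pi.mulSingle i (Units.mk0 _ (one_sub_C_mul_X_ne_zero (a : ℂ)))

theorem fundTuple_mem (i : I) (a : ℂˣ) : fundTuple i a ∈ polyTuples I := by
  intro j
  rcases eq_or_ne j i with rfl | h
  · exact ⟨1 - C (a : ℂ) * X, by simp, by simp [fundTuple]⟩
  · exact ⟨1, by simp, by simp [fundTuple, h]⟩

/-- The fundamental ℓ-weight `π_{i,a}`. -/
def fund (i : I) (a : ℂˣ) : ellWeights I :=
  ⟨fundTuple i a, Subgroup.subset_closure (fundTuple_mem i a)⟩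

/-- The formula for `T̃_i` on `I`-tuples `ϖ` of rational functions; here `q_i = q ^ d i`. -/
def braidFun (A : Matrix I I ℤ) (d : I → ℕ) (q : ℂˣ) (i : I) (ϖ : I → (RatFunc ℂ)ˣ) :
    I → (RatFunc ℂ)ˣ := fun j =>
  if j = i then (dilateUnits ((q ^ d i) ^ 2) (ϖ i))⁻¹
  else if A j i = -1 then ϖ j * dilateUnits (q ^ d i) (ϖ i)
  else if A j i = -2 then ϖ j * dilateUnits (q ^ 3) (ϖ i) * dilateUnits q (ϖ i)
  else if A j i = -3 then
    ϖ j * dilateUnits (q ^ 5) (ϖ i) * dilateUnits (q ^ 3) (ϖ i) * dilateUnits q (ϖ i)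
  else ϖ j

/-- `braidFun` is a group homomorphism. -/
def braidHom (A : Matrix I I ℤ) (d : I → ℕ) (q : ℂˣ) (i : I) :
    (I → (RatFunc ℂ)ˣ) →* (I → (RatFunc ℂ)ˣ) :=
  MonoidHom.mk' (braidFun A d q i) (by
    intro x y
    funext j
    simp only [braidFun, Pi.mul_apply]
    split_ifs
    · simp only [map_mul, mul_inv]
    · rw [map_mul, mul_mul_mul_comm]
    · rw [map_mul, map_mul]; ac_rfl
    · rw [map_mul, map_mul, map_mul]; ac_rfl
    · rfl)

theorem dilate_algebraMap (c : ℂˣ) (p : ℂ[X]) :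
    dilate c (algebraMap ℂ[X] (RatFunc ℂ) p) =
      algebraMap ℂ[X] (RatFunc ℂ) (p.comp (C (c : ℂ) * X)) := by
  have h := RatFunc.map_apply_div (φ := compRingHom (C (c : ℂ) * X)) (by
    intro p hp
    rw [Submonoid.mem_comap, mem_nonZeroDivisors_iff_ne_zero]
    rw [mem_nonZeroDivisors_iff_ne_zero] at hp
    simpa [coe_compRingHom_apply, comp_C_mul_X_eq_zero_iff] using hp) p 1
  simpa [dilate, RatFunc.coe_mapRingHom_eq_coe_map] using h

/-- `T̃_i` preserves the ℓ-weight lattice. -/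
theorem braidHom_mem (A : Matrix I I ℤ) (d : I → ℕ) (q : ℂˣ) (i : I) (x : I → (RatFunc ℂ)ˣ)
    (hx : x ∈ ellWeights I) : braidHom A d q i x ∈ ellWeights I := by
  induction hx using Subgroup.closure_induction with
  | one => rw [map_one]; exact one_mem _
  | mul x y _ _ hx hy => rw [map_mul]; exact mul_mem hx hy
  | inv x _ hx => rw [map_inv]; exact inv_mem hx
  | mem x hx =>
    have hdil : ∀ c : ℂˣ, ∃ p : ℂ[X], p.coeff 0 = 1 ∧
        ((dilateUnits c (x i) : (RatFunc ℂ)ˣ) : RatFunc ℂ) = algebraMap ℂ[X] (RatFunc ℂ) p := by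
      intro c
      obtain ⟨p, hp, hp'⟩ := hx i
      refine ⟨p.comp (C (c : ℂ) * X), ?_, ?_⟩
      · rw [coeff_zero_eq_eval_zero] at hp ⊢
        simpa [eval_comp] using hp
      · rw [← dilate_algebraMap, ← hp']
        rfl
    have hmul : ∀ y z : (RatFunc ℂ)ˣ,
        (∃ p : ℂ[X], p.coeff 0 = 1 ∧ (y : RatFunc ℂ) = algebraMap ℂ[X] (RatFunc ℂ) p) →
        (∃ p : ℂ[X], p.coeff 0 = 1 ∧ (z : RatFunc ℂ) = algebraMap ℂ[X] (RatFunc ℂ) p) →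
        ∃ p : ℂ[X], p.coeff 0 = 1 ∧
          ((y * z : (RatFunc ℂ)ˣ) : RatFunc ℂ) = algebraMap ℂ[X] (RatFunc ℂ) p := by
      rintro y z ⟨p, hp, hp'⟩ ⟨r, hr, hr'⟩
      exact ⟨p * r, by simp [mul_coeff_zero, hp, hr], by simp [hp', hr']⟩
    set D : I → (RatFunc ℂ)ˣ := Pi.mulSingle i (dilateUnits ((q ^ d i) ^ 2) (x i)) with hD
    have hDm : D ∈ polyTuples I := by
      intro j
      rcases eq_or_ne j i with rfl | h
      · simpa [hD] using hdil _
      · exact ⟨1, by simp, by simp [hD, h]⟩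
    have hE : Function.update (braidHom A d q i x) i 1 ∈ polyTuples I := by
      intro j
      rcases eq_or_ne j i with rfl | h
      · exact ⟨1, by simp, by simp⟩
      · rw [Function.update_of_ne h]
        change ∃ p : ℂ[X], p.coeff 0 = 1 ∧
          ((braidFun A d q i x j : (RatFunc ℂ)ˣ) : RatFunc ℂ) = algebraMap ℂ[X] (RatFunc ℂ) p
        rw [braidFun, if_neg h]
        split_ifs
        · exact hmul _ _ (hx j) (hdil _)
        · exact hmul _ _ (hmul _ _ (hx j) (hdil _)) (hdil _)
        · exact hmul _ _ (hmul _ _ (hmul _ _ (hx j) (hdil _)) (hdil _)) (hdil _)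
        · exact hx j
    have hEq : braidHom A d q i x = D⁻¹ * Function.update (braidHom A d q i x) i 1 := by
      funext j
      rcases eq_or_ne j i with rfl | h
      · simp [hD, braidHom, braidFun]
      · simp [hD, h]
    rw [hEq]
    exact mul_mem (inv_mem (Subgroup.subset_closure hDm)) (Subgroup.subset_closure hE)

/-- The operator `T̃_i` on the ℓ-weight lattice. -/
def braid (A : Matrix I I ℤ) (d : I → ℕ) (q : ℂˣ) (i : I) : Monoid.End (ellWeights I) :=
  ((braidHom A d q i).comp (ellWeights I).subtype).codRestrict (ellWeights I)
    fun x => braidHom_mem A d q i x x.2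

/-- The composite `T̃_{i₁} ⋯ T̃_{i_r}`. -/
def braidWord (A : Matrix I I ℤ) (d : I → ℕ) (q : ℂˣ) (l : List I) : Monoid.End (ellWeights I) :=
  (l.map (braid A d q)).prod

/-- `α_{i,a} = (T̃_i π_{i,a})⁻¹ π_{i,a}`. -/
def ellRoot (A : Matrix I I ℤ) (d : I → ℕ) (q : ℂˣ) (i : I) (a : ℂˣ) : ellWeights I :=
  (braid A d q i (fund i a))⁻¹ * fund i a

/-- `𝒬⁺`, the monoid generated by the `α_{i,a}`. -/
def ellRootsPos (A : Matrix I I ℤ) (d : I → ℕ) (q : ℂˣ) : Submonoid (ellWeights I) :=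
  Submonoid.closure {x | ∃ (i : I) (a : ℂˣ), x = ellRoot A d q i a}

/-- `𝒬⁻ = (𝒬⁺)⁻¹`. -/
def ellRootsNeg (A : Matrix I I ℤ) (d : I → ℕ) (q : ℂˣ) : Submonoid (ellWeights I) :=
  (ellRootsPos A d q).map (invMonoidHom : ellWeights I →* ellWeights I)

/-- `ϖ ≼ ϖ'` iff `ϖ ∈ ϖ' 𝒬⁻`. -/
def ellLE (A : Matrix I I ℤ) (d : I → ℕ) (q : ℂˣ) (ϖ ϖ' : ellWeights I) : Prop :=
  ∃ β ∈ ellRootsNeg A d q, ϖ = ϖ' * β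

end Lattices

section RootDatum

variable {ι k M N : Type*} [Field k] [AddCommGroup M] [Module k M]
  [AddCommGroup N] [Module k N] {R : RootPairing ι k M N}

theorem reflection_reflectionPerm' (i j : ι) :
    RootPairing.Equiv.reflection R (R.reflectionPerm j i) =
      RootPairing.Equiv.reflection R j * RootPairing.Equiv.reflection R i *
        RootPairing.Equiv.reflection R j := by
  apply RootPairing.Equiv.weightHom_injective R
  rw [map_mul, map_mul]
  simp only [RootPairing.Equiv.weightHom_apply, RootPairing.Equiv.reflection_weightEquiv]
  exact R.reflection_reflectionPerm

theorem simpleWord_append (b : R.Base) (l l' : List b.support) :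
    simpleWord b (l ++ l') = simpleWord b l * simpleWord b l' := by
  simp [simpleWord]

/-- Every element of the Weyl group has a reduced expression. -/
theorem exists_isReducedExpression [CharZero k] [Finite ι] [R.IsRootSystem] [R.IsCrystallographic]
    [R.IsReduced] (b : R.Base) (w : R.weylGroup) :
    ∃ l : List b.support, IsReducedExpression b l w := by
  have key : ∃ l : List b.support, simpleWord b l = w := by
    have hrefl : ∀ i : ι, ∃ l : List b.support,
        (simpleWord b l : RootPairing.Aut R) = RootPairing.Equiv.reflection R i := by
      intro i
      refine b.induction_reflect i (p := fun i => ∃ l : List b.support,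
        (simpleWord b l : RootPairing.Aut R) = RootPairing.Equiv.reflection R i) ?_ ?_ ?_
      · rintro i ⟨l, hl⟩
        exact ⟨l ++ l ++ l, by
          rw [simpleWord_append, simpleWord_append, reflection_reflectionPerm']
          simp [hl]⟩
      · intro i hi
        exact ⟨[⟨i, hi⟩], by simp [simpleWord, RootPairing.weylGroup.ofIdx]⟩
      · rintro i j ⟨l, hl⟩ hj
        exact ⟨[⟨j, hj⟩] ++ l ++ [⟨j, hj⟩], by
          rw [simpleWord_append, simpleWord_append, reflection_reflectionPerm']
          simp [simpleWord, RootPairing.weylGroup.ofIdx] at hl ⊢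
          simp [hl]⟩
    obtain ⟨w, hw⟩ := w
    suffices ∃ l : List b.support, (simpleWord b l : RootPairing.Aut R) = w by
      obtain ⟨l, hl⟩ := this
      exact ⟨l, Subtype.ext hl⟩
    induction hw using RootPairing.weylGroup.induction with
    | mem i => exact hrefl i
    | one => exact ⟨[], by simp [simpleWord]⟩
    | mul x y _ _ hx hy =>
      obtain ⟨l, hl⟩ := hx
      obtain ⟨l', hl'⟩ := hy
      exact ⟨l ++ l', by rw [simpleWord_append]; simp [hl, hl']⟩
  classical
  have hn : ∃ n, ∃ l : List b.support, l.length = n ∧ simpleWord b l = w :=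
    let ⟨l, hl⟩ := key; ⟨_, l, rfl, hl⟩
  obtain ⟨l, hl, hw⟩ := Nat.find_spec hn
  exact ⟨l, hw, fun l' h' => hl ▸ Nat.find_min' hn ⟨l', rfl, h'⟩⟩

end RootDatum

end QAff

end

noncomputable section

namespace QAff

open Polynomial CoxeterSystem

/-! If the `i`-th coordinate of an ℓ-weight is a polynomial with constant term one, it is a product
of factors `1 - a u`, and applying `T̃_i` divides the ℓ-weight by the corresponding product of
`α_{i,a}` (`ellLE_braid`). Applying the letters of a reduced word from right to left, it therefore
suffices that before each `T̃_i` the `i`-th coordinate of the current ℓ-weight is such a polynomial.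

Let `X` act on rational functions by `u ↦ q u`. Then `𝒫` pairs with `ℤ[X]^I`, and `T̃_i` is adjoint
to a pseudo-reflection `gen i` that becomes a simple reflection of the dual root system at `X = 1`.
The required coordinate is the pairing of the dominant weight with a deformed positive root, namely
a reduced word applied to a basis vector (`pairTuple_braidWord`). Non-negative coefficients of this
vector give a polynomial coordinate.

This positivity (`IsReduced.word_single_mem`) deforms the theorem that `w α_s` is a positive root
when `s` lengthens `w`. The classical reduction to rank two applies: alternating letters `t, s, t,
…` are stripped from the end of the word until both simple roots have positive image. The
intermediate coefficients are explicit in each rank-two type (`chain_of_pairType`). Stripping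
replaces one reduced word by another, so Matsumoto's theorem for the deformed operators is also
needed (`IsReduced.word_eq`). Signs of roots are read off from heights at `X = 1`. -/

/-! ### Braid relations for pairs of pseudo-reflections -/

/-- The relations between the coefficients of two pseudo-reflections `v ↦ v + f v • e` and
`v ↦ v + g v • e'` with `f e = -1 - p`, `g e' = -1 - r`, `f e' = x`, `g e = y` which force the
braid relation of length `m`; positivity of the auxiliary element is relative to `S`. -/
inductive PairType {K : Type*} [CommRing K] (S : Subsemiring K) (p r x y : K) : ℕ → Prop
  | two (hx : x = 0) (hy : y = 0) : PairType S p r x y 2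
  | three (hp : p = r) (hxy : x * y = p) : PairType S p r x y 3
  | four (hxy : x * y = p + r) : PairType S p r x y 4
  | six (g : K) (hg : g ∈ S) (hxy : x * y = p + r + g) (hgg : g * g = p * r) :
      PairType S p r x y 6

theorem PairType.map {K L : Type*} [CommRing K] [CommRing L] {S : Subsemiring K}
    {p r x y : K} {m : ℕ} (h : PairType S p r x y m) (φ : K →+* L) :
    PairType ⊤ (φ p) (φ r) (φ x) (φ y) m := by
  cases h with
  | two hx hy => exact .two (by simp [hx]) (by simp [hy])
  | three hp hxy => exact .three (by simp [hp]) (by simp [← hxy])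
  | four hxy => exact .four (by simp [← map_mul, hxy])
  | six g hg hxy hgg =>
    exact .six (φ g) trivial (by simp [← map_mul, hxy]) (by rw [← map_mul, hgg, map_mul])

/-- Pseudo-reflections satisfy the braid relation prescribed by their pair type. -/
theorem PairType.braid_relation {K V I : Type*} [CommRing K] [AddCommGroup V] [Module K V]
    (T : I → Module.End K V) (e : I → V) (f : I → V →ₗ[K] K)
    (hT : ∀ i v, T i v = v + f i v • e i) {S : Subsemiring K} {p r : K} {i j : I} {m : ℕ}
    (h : PairType S p r (f i (e j)) (f j (e i)) m)
    (hi : f i (e i) = -1 - p) (hj : f j (e j) = -1 - r) :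
    ((alternatingWord i j m).map T).prod = ((alternatingWord j i m).map T).prod := by
  ext v
  generalize hx : f i (e j) = x at h
  generalize hy : f j (e i) = y at h
  cases h with
  | two hx' hy' =>
    simp only [alternatingWord, List.concat_eq_append, List.nil_append, List.map_append,
      List.map_cons, List.map_nil, List.prod_append, List.prod_cons, List.prod_nil, mul_one,
      Module.End.mul_apply, hT, map_add, map_smul, smul_eq_mul, hx, hy, hx', hy']
    module
  | three hp hxy =>
    simp only [alternatingWord, List.concat_eq_append, List.nil_append, List.map_append,
      List.map_cons, List.map_nil, List.prod_append, List.prod_cons, List.prod_nil, mul_one,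
      Module.End.mul_apply, hT, map_add, map_smul, smul_eq_mul, hx, hy, hi, hj]
    subst hp
    match_scalars
    · ring
    · linear_combination -(f i v) * hxy
    · linear_combination (f j v) * hxy
  | four hxy =>
    simp only [alternatingWord, List.concat_eq_append, List.nil_append, List.map_append,
      List.map_cons, List.map_nil, List.prod_append, List.prod_cons, List.prod_nil, mul_one,
      Module.End.mul_apply, hT, map_add, map_smul, smul_eq_mul, hx, hy, hi, hj]
    obtain rfl : r = x * y - p := by rw [hxy]; ring
    match_scalars <;> ring
  | six g hg hxy hgg =>
    simp only [alternatingWord, List.concat_eq_append, List.nil_append, List.map_append,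
      List.map_cons, List.map_nil, List.prod_append, List.prod_cons, List.prod_nil, mul_one,
      Module.End.mul_apply, hT, map_add, map_smul, smul_eq_mul, hx, hy, hi, hj]
    obtain rfl : g = x * y - p - r := by rw [hxy]; ring
    match_scalars
    · ring
    · linear_combination -(f i v) * y * hgg
    · linear_combination (f j v) * x * hgg

/-! ### Deformed Cartan matrices -/

/-- Integer polynomials with non-negative coefficients. -/
def natPoly : Subsemiring ℤ[X] := (mapRingHom (Nat.castRingHom ℤ)).rangeS

theorem X_mem_natPoly : (X : ℤ[X]) ∈ natPoly := ⟨X, by simp⟩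

theorem eval_one_nonneg {c : ℤ[X]} (hc : c ∈ natPoly) : 0 ≤ c.eval 1 := by
  obtain ⟨c, rfl⟩ := hc
  rw [coe_mapRingHom, ← map_one (Nat.castRingHom ℤ), eval_map_apply]
  simp

/-- A Cartan matrix of rank-two finite type `A`, with a deformation of the representation
`s_i e_j = e_j - A i j e_i`, specialising to it at `X = 1`. -/
structure DeformedCartan (I : Type*) where
  /-- The undeformed coefficients. -/
  A : I → I → ℤ
  /-- `-p i` is the eigenvalue of the `i`-th generator other than one. -/
  p : I → ℤ[X]
  /-- The deformed off-diagonal coefficients. -/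
  D : I → I → ℤ[X]
  A_self : ∀ i, A i i = 2
  p_mem : ∀ i, p i ∈ natPoly
  D_mem : ∀ i j, D i j ∈ natPoly
  eval_p : ∀ i, (p i).eval 1 = 1
  eval_D : ∀ i j, i ≠ j → (D i j).eval 1 = -A i j
  exists_pairType : ∀ i j, i ≠ j → ∃ m, PairType natPoly (p i) (p j) (D i j) (D j i) m

namespace DeformedCartan

variable {I : Type*} [DecidableEq I] (c : DeformedCartan I)

/-- The coefficient of `e_i` in `(T_i - 1) e_j`. -/
def coef (i j : I) : ℤ[X] := if i = j then -1 - c.p i else c.D i j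

variable [Fintype I]

/-- The functional `f_i` with `T_i v = v + f_i v • e_i`. -/
def functional (i : I) : (I → ℤ[X]) →ₗ[ℤ[X]] ℤ[X] := Fintype.linearCombination ℤ[X] (c.coef i)

@[simp] theorem functional_single (i j : I) : c.functional i (Pi.single j 1) = c.coef i j := by
  simp [functional]

/-- The generator `T_i v = v + f_i v • e_i` of the deformed representation. -/
def gen (i : I) : Module.End ℤ[X] (I → ℤ[X]) :=
  LinearMap.id + (c.functional i).smulRight (Pi.single i 1)

theorem gen_apply (i : I) (v : I → ℤ[X]) :
    c.gen i v = v + c.functional i v • Pi.single i (1 : ℤ[X]) := by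
  simp [gen]

theorem gen_single_self (i : I) :
    c.gen i (Pi.single i 1) = -(c.p i • Pi.single i (1 : ℤ[X])) := by
  rw [gen_apply, functional_single, coef, if_pos rfl]
  module

theorem gen_single_of_ne {i j : I} (h : i ≠ j) :
    c.gen i (Pi.single j 1) = Pi.single j 1 + c.D i j • Pi.single i (1 : ℤ[X]) := by
  rw [gen_apply, functional_single, coef, if_neg h]

/-- The product of generators along a word. -/
def word (l : List I) : Module.End ℤ[X] (I → ℤ[X]) := (l.map c.gen).prod

theorem word_append (l l' : List I) : c.word (l ++ l') = c.word l * c.word l' := by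
  simp [word]

theorem word_singleton (i : I) : c.word [i] = c.gen i := by
  simp [word]

theorem word_alternatingWord {i j : I} {m : ℕ} (hij : i ≠ j)
    (h : PairType natPoly (c.p i) (c.p j) (c.D i j) (c.D j i) m) :
    c.word (alternatingWord i j m) = c.word (alternatingWord j i m) := by
  refine PairType.braid_relation (S := natPoly) (p := c.p i) (r := c.p j) c.gen
    (fun i => Pi.single i 1) c.functional c.gen_apply ?_ ?_ ?_
  · simpa [coef, hij, hij.symm] using h
  · simp [coef]
  · simp [coef]

/-- `c.Chain n y z C C'`: when the letters `y, z, y, …` are removed from a word `n` times, the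
vector `C e_y + C' e_z` stays non-negative, and ends up as a multiple of a single basis vector. -/
def Chain : ℕ → I → I → ℤ[X] → ℤ[X] → Prop
  | 0, _, _, C, C' => C ∈ natPoly ∧ C' = 0
  | n + 1, y, z, C, C' => C ∈ natPoly ∧ C' ∈ natPoly ∧
      Chain n z y C' (c.D y z * C' - c.p y * C)

omit [DecidableEq I] [Fintype I] in
theorem Chain.nonneg {c : DeformedCartan I} {n : ℕ} {y z : I} {C C' : ℤ[X]}
    (h : c.Chain n y z C C') :
    C ∈ natPoly ∧ C' ∈ natPoly := by
  cases n with
  | zero => exact ⟨h.1, h.2 ▸ zero_mem _⟩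
  | succ n => exact ⟨h.1, h.2.1⟩

omit [DecidableEq I] [Fintype I] in
-- The chain starts at `T_i e_j = e_j + D i j • e_i` and runs through the deformed positive roots of
-- the rank-two subsystem. The pair relations cancel every subtraction: in length six the successive
-- coefficients are `1, x, p + g, x g, g p, 0`, with `p = c.p i`. One letter produced the starting
-- vector and the last root is a multiple of a basis vector, whence `m = n + 2`.
theorem chain_of_pairType {i j : I} {m : ℕ}
    (h : PairType natPoly (c.p i) (c.p j) (c.D i j) (c.D j i) m) :
    ∃ n, m = n + 2 ∧ c.Chain n j i 1 (c.D i j) := by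
  have hp := c.p_mem
  have hD := c.D_mem
  generalize hx : c.D i j = x at h
  generalize hy : c.D j i = y at h
  have hxm : x ∈ natPoly := hx ▸ hD i j
  have hym : y ∈ natPoly := hy ▸ hD j i
  cases h with
  | two hx' hy' => exact ⟨0, rfl, one_mem _, hx'⟩
  | three hpr hxy =>
    refine ⟨1, rfl, one_mem _, hxm, hxm, ?_⟩
    rw [hy]; linear_combination hxy + hpr
  | four hxy =>
    have e1 : y * x - c.p j * 1 = c.p i := by linear_combination hxy
    refine ⟨2, rfl, one_mem _, hxm, hxm, ?_, ?_⟩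
    · rw [hy, e1]; exact hp i
    · rw [hy, e1, hx]; exact ⟨hp i, by ring⟩
  | six g hg hxy hgg =>
    have e1 : y * x - c.p j * 1 = c.p i + g := by linear_combination hxy
    have e2 : x * (c.p i + g) - c.p i * x = x * g := by ring
    have e3 : y * (x * g) - c.p j * (c.p i + g) = g * c.p i := by
      linear_combination g * hxy + hgg
    refine ⟨4, rfl, one_mem _, hxm, hxm, ?_, ?_⟩
    · rw [hy, e1]; exact add_mem (hp i) hg
    · rw [hy, e1, hx, e2]
      refine ⟨add_mem (hp i) hg, mul_mem hxm hg, ?_⟩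
      rw [hy, e3]
      refine ⟨mul_mem hxm hg, mul_mem hg (hp i), mul_mem hg (hp i), ?_⟩
      rw [hx]; ring

end DeformedCartan

/-! ### Words in reflection groups -/

/-- A group generated by reflections `s i`, with the height `h w i` of `w` applied to the `i`-th
simple root. -/
structure HeightSystem {I : Type*} (c : DeformedCartan I) (G : Type*) [Group G] where
  /-- The simple reflections. -/
  s : I → G
  /-- The height of `w` applied to a simple root. -/
  h : G → I → ℤ
  s_mul_self : ∀ i, s i * s i = 1
  h_one : ∀ i, 0 < h 1 i
  h_ne : ∀ w i, h w i ≠ 0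
  h_mul : ∀ w i j, h (w * s i) j = h w j - c.A i j * h w i
  exchange : ∀ w i j, 0 < h w i → h (s j * w) i < 0 → s j * w = w * s i
  braid : ∀ i j m, i ≠ j → PairType natPoly (c.p i) (c.p j) (c.D i j) (c.D j i) m →
    ((alternatingWord i j m).map s).prod = ((alternatingWord j i m).map s).prod

namespace HeightSystem

variable {I G : Type*} [Group G] {c : DeformedCartan I} (H : HeightSystem c G)

/-- The product of simple reflections along a word. -/
def prod (l : List I) : G := (l.map H.s).prod

theorem prod_append (l l' : List I) : H.prod (l ++ l') = H.prod l * H.prod l' := by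
  simp [prod]

theorem prod_singleton (i : I) : H.prod [i] = H.s i := by
  simp [prod]

theorem mul_s_s (w : G) (i : I) : w * H.s i * H.s i = w := by
  rw [mul_assoc, H.s_mul_self, mul_one]

theorem h_mul_self (w : G) (i : I) : H.h (w * H.s i) i = -H.h w i := by
  rw [H.h_mul, c.A_self]; ring

/-- A word of minimal length among those with the same product. -/
def IsReduced (l : List I) : Prop := ∀ l', H.prod l' = H.prod l → l.length ≤ l'.length

variable {H}

/-- The exchange condition. Reading the word from the right, the image of the simple root changes
sign at some letter `j`; there `exchange` turns `s_j` into `s_i` on the right, so that letter can be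
deleted. -/
theorem exists_shorter (l : List I) {i : I} (hi : H.h (H.prod l) i < 0) :
    ∃ l', l'.length + 1 = l.length ∧ H.prod l' = H.prod l * H.s i := by
  induction l with
  | nil => exact absurd (H.h_one i) (by simpa [prod] using hi.le)
  | cons j l ih =>
    have hcons : ∀ l, H.prod (j :: l) = H.s j * H.prod l := fun l => by simp [prod]
    rcases lt_or_gt_of_ne (H.h_ne (H.prod l) i) with h | h
    · obtain ⟨l', hl, hp⟩ := ih h
      exact ⟨j :: l', by simp [hl], by rw [hcons, hcons, hp, mul_assoc]⟩
    · refine ⟨l, rfl, ?_⟩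
      rw [hcons] at hi ⊢
      rw [H.exchange _ _ _ h hi, mul_s_s]

theorem IsReduced.of_append {l l' : List I} (h : H.IsReduced (l ++ l')) : H.IsReduced l :=
  fun l₁ hl₁ => by simpa using h (l₁ ++ l') (by rw [prod_append, prod_append, hl₁])

theorem IsReduced.congr {l l' : List I} (h : H.IsReduced l) (hp : H.prod l' = H.prod l)
    (hl : l'.length = l.length) : H.IsReduced l' := fun l₁ hl₁ => by
  rw [hl]; exact h l₁ (hl₁.trans hp)

/-- Were the height already negative for the prefix, `exists_shorter` would produce a word two
letters shorter with the same product. -/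
theorem IsReduced.height_neg {l : List I} {i : I} (h : H.IsReduced (l ++ [i])) :
    H.h (H.prod (l ++ [i])) i < 0 := by
  rw [prod_append, prod_singleton, h_mul_self, neg_lt_zero]
  by_contra hneg
  obtain ⟨l', hl', hp⟩ := exists_shorter l (lt_of_le_of_ne (not_lt.mp hneg) (H.h_ne _ _))
  have := h l' (by rw [hp, prod_append, prod_singleton])
  simp at this
  omega

theorem IsReduced.exists_shorter {l : List I} (hl : H.IsReduced l) {i : I}
    (hi : H.h (H.prod l) i < 0) :
    ∃ l', l'.length + 1 = l.length ∧ H.prod l' = H.prod l * H.s i ∧ H.IsReduced (l' ++ [i]) ∧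
      H.prod (l' ++ [i]) = H.prod l := by
  obtain ⟨l', hlen, hp⟩ := HeightSystem.exists_shorter l hi
  have hp' : H.prod (l' ++ [i]) = H.prod l := by
    rw [prod_append, prod_singleton, hp, mul_s_s]
  exact ⟨l', hlen, hp, hl.congr hp' (by simpa using hlen), hp'⟩

/-- Removing one letter does not change the height of a transported combination. -/
theorem height_step {w : G} {y z : I} (hyz : y ≠ z) (C C' : ℤ[X]) :
    C'.eval 1 * H.h (w * H.s y) z +
      (c.D y z * C' - c.p y * C).eval 1 * H.h (w * H.s y) y =
    C.eval 1 * H.h w y + C'.eval 1 * H.h w z := by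
  rw [h_mul_self, H.h_mul, eval_sub, eval_mul, eval_mul, c.eval_p, c.eval_D _ _ hyz]
  ring

/-- A non-negative combination of negative total height, with the `z`-height positive, must have
negative `y`-height, so `y` can be stripped. The combination's height is unchanged and the
`y`-height becomes positive, so the situation recurs with the roles exchanged. In this way `n + 1`
alternating letters are removed. -/
theorem exists_descent_of_neg (n : ℕ) (l : List I) {y z : I} (hyz : y ≠ z) {C C' : ℤ[X]}
    (hch : c.Chain n y z C C') (hz : 0 < H.h (H.prod l) z)
    (hneg : C.eval 1 * H.h (H.prod l) y + C'.eval 1 * H.h (H.prod l) z < 0) :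
    ∃ l', l'.length + (n + 1) = l.length ∧
      H.prod (l' ++ alternatingWord z y (n + 1)) = H.prod l := by
  have hC := eval_one_nonneg hch.nonneg.1
  have hC' := eval_one_nonneg hch.nonneg.2
  have hy : H.h (H.prod l) y < 0 := by
    by_contra hy
    have := mul_nonneg hC (not_lt.mp hy)
    have := mul_nonneg hC' hz.le
    linarith
  obtain ⟨l', hlen, hp⟩ := exists_shorter l hy
  induction n generalizing l l' y z C C' with
  | zero =>
    refine ⟨l', by simpa using hlen, ?_⟩
    simp [alternatingWord, prod_append, prod_singleton, hp, mul_s_s]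
  | succ n ih =>
    have h1 : 0 < H.h (H.prod l') y := by rw [hp, h_mul_self]; omega
    have h2 := height_step (H := H) (w := H.prod l) hyz C C'
    rw [← hp] at h2
    have hch' := hch.2.2
    rw [← h2] at hneg
    have hC1 := eval_one_nonneg hch'.nonneg.1
    have hC1' := eval_one_nonneg hch'.nonneg.2
    have hy1 : H.h (H.prod l') z < 0 := by
      by_contra hy
      have := mul_nonneg hC1 (not_lt.mp hy)
      have := mul_nonneg hC1' h1.le
      linarith
    obtain ⟨l₁, hlen₁, hp₁⟩ := exists_shorter l' hy1
    obtain ⟨l₂, hlen₂, hp₂⟩ := ih l' hyz.symm hch' h1 hneg hC1 hC1' hy1 l₁ hlen₁ hp₁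
    refine ⟨l₂, by omega, ?_⟩
    rw [alternatingWord, List.concat_eq_append, ← List.append_assoc, prod_append, hp₂,
      prod_singleton, hp, mul_s_s]

variable [Fintype I] [DecidableEq I]

/-- The deformed representation is independent of the reduced word. -/
theorem IsReduced.word_eq (k : ℕ) : ∀ l l' : List I, l.length = k → H.IsReduced l →
    H.IsReduced l' → H.prod l = H.prod l' → c.word l = c.word l' := by
  induction k with
  | zero =>
    intro l l' hk hl hl' hp
    have := hl' l hp
    obtain rfl : l = [] := List.length_eq_zero_iff.mp hk
    obtain rfl : l' = [] := List.length_eq_zero_iff.mp (by simpa using this)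
    rfl
  | succ k ih =>
    intro l l' hk hl hl' hp
    have hlen : l.length = l'.length := le_antisymm (hl l' hp.symm) (hl' l hp)
    obtain ⟨l₁, t, rfl⟩ : ∃ l₁ t, l = l₁ ++ [t] :=
      ⟨l.dropLast, _, (List.dropLast_append_getLast (by rintro rfl; simp at hk)).symm⟩
    obtain ⟨l₂, s, rfl⟩ : ∃ l₁ t, l' = l₁ ++ [t] :=
      ⟨l'.dropLast, _, (List.dropLast_append_getLast (by rintro rfl; simp at hlen)).symm⟩
    have hk₁ : l₁.length = k := by simpa using hk
    have hk₂ : l₂.length = k := by simp at hlen; omega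
    -- Words with a common last letter reduce to the inductive hypothesis by cancelling it.
    have last : ∀ (l₁ l₂ : List I) (t : I), l₁.length = k → H.IsReduced (l₁ ++ [t]) →
        H.IsReduced (l₂ ++ [t]) → H.prod (l₁ ++ [t]) = H.prod (l₂ ++ [t]) →
        c.word (l₁ ++ [t]) = c.word (l₂ ++ [t]) := by
      intro l₁ l₂ t h₁ hr₁ hr₂ hpp
      rw [prod_append, prod_append] at hpp
      rw [c.word_append, c.word_append, ih l₁ l₂ h₁ hr₁.of_append hr₂.of_append
        (mul_right_cancel hpp)]
    rcases eq_or_ne t s with rfl | hts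
    · exact last _ _ _ hk₁ hl hl' hp
    obtain ⟨m, hm⟩ := c.exists_pairType t s hts
    obtain ⟨n, rfl, hch⟩ := c.chain_of_pairType hm
    have ht := hl.height_neg
    have hs := hl'.height_neg
    rw [← hp] at hs
    obtain ⟨l₃, hlen₃, hp₃⟩ := HeightSystem.exists_shorter _ ht
    have ht₃ : 0 < H.h (H.prod l₃) t := by rw [hp₃, h_mul_self]; omega
    -- For `w` the common product, this expresses the height of `w α_s` as that of `w s_t` applied
    -- to `s_t α_s`, the starting vector of the chain.
    have hstep := height_step (H := H) (w := H.prod (l₁ ++ [t])) hts 0 1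
    simp only [mul_one, mul_zero, sub_zero, eval_one, eval_zero, zero_mul, one_mul,
      zero_add] at hstep
    obtain ⟨l₀, hlen₀, hp₀⟩ := exists_descent_of_neg n l₃ hts.symm hch ht₃ (by
      rw [hp₃, eval_one, one_mul, hstep]; exact hs)
    -- Since `w` makes both `α_t` and `α_s` negative, it ends in the longest element of the dihedral
    -- group of `s` and `t`. The two alternating expressions of that element link the given words.
    have hpt : H.prod (l₀ ++ alternatingWord s t (n + 2)) = H.prod (l₁ ++ [t]) := by
      rw [alternatingWord, List.concat_eq_append, ← List.append_assoc, prod_append, hp₀,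
        prod_singleton, hp₃, mul_s_s]
    have hps : H.prod (l₀ ++ alternatingWord t s (n + 2)) = H.prod (l₁ ++ [t]) := by
      rw [← hpt, prod_append, prod_append]
      exact congrArg _ (H.braid t s _ hts hm)
    have hrt := hl.congr hpt (by simp at hlen₃ ⊢; omega)
    have hrs := hl.congr hps (by simp at hlen₃ ⊢; omega)
    have h1 : c.word (l₁ ++ [t]) = c.word (l₀ ++ alternatingWord s t (n + 2)) := by
      rw [alternatingWord, List.concat_eq_append, ← List.append_assoc] at hrt hpt ⊢
      exact last _ _ _ hk₁ hl hrt hpt.symm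
    have h2 : c.word (l₂ ++ [s]) = c.word (l₀ ++ alternatingWord t s (n + 2)) := by
      rw [alternatingWord, List.concat_eq_append, ← List.append_assoc] at hrs hps ⊢
      exact last _ _ _ hk₂ hl' hrs (hps.trans hp).symm
    rw [h1, h2, c.word_append, c.word_append, c.word_alternatingWord hts hm]

/-- Stripping stops either when both heights are positive or when the chain has run out. In the
latter case only one basis vector is left, and the positive total height makes its height positive.
-/
theorem IsReduced.exists_descent_of_pos (n : ℕ) (l : List I) (hl : H.IsReduced l) {y z : I}
    (hyz : y ≠ z) {C C' : ℤ[X]} (hch : c.Chain n y z C C') (hz : 0 < H.h (H.prod l) z)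
    (hpos : 0 < C.eval 1 * H.h (H.prod l) y + C'.eval 1 * H.h (H.prod l) z) :
    ∃ (l' : List I) (y' z' : I) (B B' : ℤ[X]), H.IsReduced l' ∧ l'.length ≤ l.length ∧
      B ∈ natPoly ∧ B' ∈ natPoly ∧ 0 < H.h (H.prod l') y' ∧ 0 < H.h (H.prod l') z' ∧
      c.word l (C • Pi.single y 1 + C' • Pi.single z 1) =
        c.word l' (B • Pi.single y' 1 + B' • Pi.single z' 1) := by
  induction n generalizing l y z C C' with
  | zero =>
    obtain ⟨hC, rfl⟩ := hch
    have hC1 := eval_one_nonneg hC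
    rw [eval_zero, zero_mul, add_zero] at hpos
    exact ⟨l, y, z, C, 0, hl, le_rfl, hC, zero_mem _, pos_of_mul_pos_right hpos hC1, hz, rfl⟩
  | succ n ih =>
    obtain ⟨hC, hC', hch⟩ := hch
    rcases lt_or_gt_of_ne (H.h_ne (H.prod l) y) with hy | hy
    · obtain ⟨l₁, hlen, hp, hr, hp'⟩ := hl.exists_shorter hy
      have h1 : 0 < H.h (H.prod l₁) y := by rw [hp, h_mul_self]; omega
      obtain ⟨l', y', z', B, B', h2, h3, h4, h5, h6, h7, h8⟩ :=
        ih l₁ hr.of_append hyz.symm hch h1 (by rw [hp, height_step hyz]; exact hpos)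
      refine ⟨l', y', z', B, B', h2, by omega, h4, h5, h6, h7, ?_⟩
      -- The exchange condition yields another reduced word, ending in `y`; independence of the
      -- reduced word allows it to replace `l`.
      rw [← h8, IsReduced.word_eq _ l _ rfl hl hr hp'.symm, c.word_append, c.word_singleton,
        Module.End.mul_apply]
      congr 1
      rw [map_add, map_smul, map_smul, c.gen_single_self, c.gen_single_of_ne hyz]
      module
    · exact ⟨l, y, z, C, C', hl, le_rfl, hC, hC', hy, hz, rfl⟩

/-- Deformed positive roots have non-negative coefficients. -/
theorem IsReduced.word_single_mem (k : ℕ) : ∀ (l : List I) (s : I), l.length = k →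
    H.IsReduced l → 0 < H.h (H.prod l) s → ∀ j, c.word l (Pi.single s 1) j ∈ natPoly := by
  induction k using Nat.strong_induction_on with
  | _ k ih =>
    intro l s hk hl hs j
    rcases List.eq_nil_or_concat l with rfl | ⟨l₁, t, rfl⟩
    · simp only [DeformedCartan.word, List.map_nil, List.prod_nil, Module.End.one_apply]
      rw [Pi.single_apply]
      split_ifs
      exacts [one_mem _, zero_mem _]
    rw [List.concat_eq_append] at *
    have ht := hl.height_neg
    have hts : t ≠ s := by rintro rfl; omega
    obtain ⟨m, hm⟩ := c.exists_pairType t s hts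
    obtain ⟨n, rfl, hch⟩ := c.chain_of_pairType hm
    have ht₁ : 0 < H.h (H.prod l₁) t := by
      rw [prod_append, prod_singleton, h_mul_self] at ht; omega
    have hstep := height_step (H := H) (w := H.prod (l₁ ++ [t])) hts 0 1
    simp only [mul_one, mul_zero, sub_zero, eval_one, eval_zero, zero_mul, one_mul,
      zero_add] at hstep
    rw [prod_append, prod_singleton, mul_s_s, ← prod_singleton, ← prod_append] at hstep
    obtain ⟨l', y', z', B, B', h2, h3, h4, h5, h6, h7, h8⟩ :=
      hl.of_append.exists_descent_of_pos n l₁ hts.symm hch ht₁ (by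
        rw [eval_one, one_mul, hstep]; exact hs)
    have hlt : l'.length < k := by rw [← hk]; simp; omega
    have : c.word (l₁ ++ [t]) (Pi.single s 1) =
        B • c.word l' (Pi.single y' 1) + B' • c.word l' (Pi.single z' 1) := by
      rw [← map_smul, ← map_smul, ← map_add, ← h8, c.word_append, Module.End.mul_apply,
        c.word_singleton, c.gen_single_of_ne hts, one_smul, add_comm]
    rw [this]
    exact add_mem (mul_mem h4 (ih _ hlt l' y' rfl h2 h6 j))
      (mul_mem h5 (ih _ hlt l' z' rfl h2 h7 j))

end HeightSystem

/-! ### Weyl groups as height systems -/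

section RootSystems

variable {ι k M N : Type*} [Field k] [AddCommGroup M] [Module k M]
  [AddCommGroup N] [Module k N] {P : RootPairing ι k M N}

theorem toLinearMap_smul_coroot (g : P.weylGroup) (x : M) (i : ι) :
    P.toLinearMap (g • x) (P.coroot (P.weylGroupToPerm g i)) = P.toLinearMap x (P.coroot i) := by
  have h1 := RootPairing.Hom.weight_coweight_transpose_apply P P
    (P.coroot (P.weylGroupToPerm g i)) (g : P.Aut).toHom
  have h2 := RootPairing.Hom.coroot_coweightMap_apply P P (P.weylGroupToPerm g i)
    (g : P.Aut).toHom
  have h3 : (g : P.Aut).toHom.indexEquiv.symm (P.weylGroupToPerm g i) = i :=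
    Equiv.symm_apply_apply _ _
  rw [h2, h3] at h1
  exact LinearMap.congr_fun h1 x

theorem weylGroup_ext {g g' : P.weylGroup} (h : ∀ x : M, g • x = g' • x) : g = g' := by
  apply Subtype.ext
  apply RootPairing.Equiv.weightHom_injective P
  ext x
  exact h x

theorem ofIdx_smul_apply (i : ι) (x : M) :
    RootPairing.weylGroup.ofIdx P i • x = x - P.toLinearMap x (P.coroot i) • P.root i := by
  rw [RootPairing.weylGroup.ofIdx_smul, RootPairing.Equiv.reflection_smul,
    RootPairing.reflection_apply]
  rfl

theorem mul_ofIdx (g : P.weylGroup) (i : ι) :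
    g * RootPairing.weylGroup.ofIdx P i =
      RootPairing.weylGroup.ofIdx P (P.weylGroupToPerm g i) * g := by
  apply weylGroup_ext
  intro x
  rw [mul_smul, mul_smul, ofIdx_smul_apply, ofIdx_smul_apply, toLinearMap_smul_coroot, smul_sub,
    smul_comm, RootPairing.weylGroup_apply_root]

theorem weylGroupToPerm_ofIdx (i : ι) :
    P.weylGroupToPerm (RootPairing.weylGroup.ofIdx P i) = P.reflectionPerm i :=
  RootPairing.Equiv.reflection_indexEquiv P i

theorem weylGroupToPerm_injective [P.IsRootSystem] :
    Function.Injective P.weylGroupToPerm := by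
  intro g g' h
  apply weylGroup_ext
  intro x
  have hx : x ∈ P.rootSpan k := by
    rw [RootPairing.rootSpan, RootPairing.IsRootSystem.span_root_eq_top]; trivial
  induction hx using Submodule.span_induction with
  | mem x hx =>
    obtain ⟨i, rfl⟩ := hx
    rw [RootPairing.weylGroup_apply_root, RootPairing.weylGroup_apply_root, h]
  | zero => simp
  | add x y _ _ hx hy => rw [smul_add, smul_add, hx, hy]
  | smul a x _ hx => rw [smul_comm g a x, hx, smul_comm g' a x]

variable [CharZero k] [Finite ι] [P.IsCrystallographic] [P.IsReduced]

/-- The Weyl group of a root system, acting on heights of roots. -/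
def weylHeightSystem (b : P.Base) (c : DeformedCartan b.support)
    (hA : ∀ i j, c.A i j = P.pairingIn ℤ j i) : HeightSystem c P.weylGroup where
  s i := RootPairing.weylGroup.ofIdx P i
  h w i := b.height (P.weylGroupToPerm w i)
  s_mul_self i := by
    apply Subtype.ext
    change RootPairing.Equiv.reflection P i * RootPairing.Equiv.reflection P i = 1
    rw [mul_eq_one_iff_eq_inv, RootPairing.Equiv.reflection_inv]
  h_one i := by
    rw [map_one]
    exact b.isPos_of_mem_support i.2
  h_ne w i := b.height_ne_zero _
  h_mul w i j := by
    rw [sub_eq_add_neg, ← neg_mul]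
    refine b.height_add_zsmul (z := -c.A i j) ?_
    rw [← RootPairing.weylGroup_apply_root, ← RootPairing.weylGroup_apply_root,
      ← RootPairing.weylGroup_apply_root, mul_smul, ofIdx_smul_apply,
      RootPairing.root_coroot_eq_pairing, ← P.algebraMap_pairingIn ℤ, hA, smul_sub, smul_comm,
      neg_smul, sub_eq_add_neg, algebraMap_int_eq, eq_intCast, Int.cast_smul_eq_zsmul]
  exchange w i j hi hj := by
    -- A simple reflection permutes the positive roots other than its own simple root.
    have hij : P.weylGroupToPerm w i = j := by
      by_contra hne
      have := RootPairing.Base.IsPos.reflectionPerm (b := b) hi j.2 hne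
      rw [map_mul, weylGroupToPerm_ofIdx, Equiv.Perm.mul_apply] at hj
      exact absurd this (not_lt.mpr hj.le)
    rw [mul_ofIdx, hij]
  braid i j m hij h := by
    -- At `X = 1` the pair type becomes one for genuine reflections, `p = r = 1`, so the computation
    -- for pseudo-reflections also gives the Coxeter relations.
    have hm := h.map (S := natPoly) ((Int.castRingHom k).comp (evalRingHom 1))
    have hco : ∀ a b : b.support, P.toLinearMap (P.root a) (P.coroot b) = (c.A b a : k) := by
      intro a b
      rw [RootPairing.root_coroot_eq_pairing, ← P.algebraMap_pairingIn ℤ, hA]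
      simp
    have key : ∀ l : List b.support, ∀ x : M,
        (l.map fun i : b.support => RootPairing.weylGroup.ofIdx P i).prod • x =
        (l.map fun i : b.support => (P.reflection i : M →ₗ[k] M)).prod x := by
      intro l
      induction l with
      | nil => intro x; simp
      | cons a l ih =>
        intro x
        rw [List.map_cons, List.map_cons, List.prod_cons, List.prod_cons, mul_smul, ih]
        rfl
    apply weylGroup_ext
    intro x
    rw [key, key]
    refine LinearMap.congr_fun (PairType.braid_relation (S := ⊤) (p := 1) (r := 1)
      (fun i : b.support => (P.reflection i : M →ₗ[k] M)) (fun i => P.root i)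
      (fun i => -P.toLinearMap.flip (P.coroot i)) ?_ ?_ ?_ ?_) x
    · intro a x
      rw [LinearMap.neg_apply, neg_smul, ← sub_eq_add_neg]
      exact ofIdx_smul_apply _ _
    · simpa [hco, c.eval_p, c.eval_D _ _ hij, c.eval_D _ _ hij.symm] using hm
    · simp only [LinearMap.neg_apply, LinearMap.flip_apply, hco, c.A_self]; norm_num
    · simp only [LinearMap.neg_apply, LinearMap.flip_apply, hco, c.A_self]; norm_num

end RootSystems

/-! ### The deformation attached to `T̃_i` -/

section DeformedCoefficients

variable {I : Type*}

/-- The exponents of `q` in the off-diagonal part of `T̃_i`. -/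
def braidCoef (A : Matrix I I ℤ) (d : I → ℕ) (i j : I) : ℤ[X] :=
  if A j i = -1 then X ^ d i
  else if A j i = -2 then X ^ 3 + X
  else if A j i = -3 then X ^ 5 + X ^ 3 + X
  else 0

/-- The deformation of the coroot representation underlying the operators `T̃_i`. -/
def braidDeformation (A : Matrix I I ℤ) (d : I → ℕ) (hA : ∀ i, A i i = 2)
    (hpair : ∀ i j, i ≠ j → (A i j, A j i) ∈
      ({(0, 0), (-1, -1), (-1, -2), (-2, -1), (-1, -3), (-3, -1)} : Set (ℤ × ℤ)))
    (hsymm : ∀ i j, (d i : ℤ) * A i j = (d j : ℤ) * A j i)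
    (hnorm : ∀ i j, A j i < -1 → d j = 1) : DeformedCartan I where
  -- The transpose appears because the operators adjoint to `T̃_i` deform the reflections of
  -- coroots.
  A i j := A j i
  p i := (X ^ d i) ^ 2
  D := braidCoef A d
  A_self := hA
  p_mem i := pow_mem (pow_mem X_mem_natPoly _) _
  D_mem i j := by
    have hX := X_mem_natPoly
    unfold braidCoef
    split_ifs
    exacts [pow_mem hX _, add_mem (pow_mem hX _) hX,
      add_mem (add_mem (pow_mem hX _) (pow_mem hX _)) hX, zero_mem _]
  eval_p i := by simp
  eval_D i j hij := by
    have := hpair i j hij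
    simp only [Set.mem_insert_iff, Set.mem_singleton_iff, Prod.mk.injEq] at this
    rcases this with ⟨h, h'⟩ | ⟨h, h'⟩ | ⟨h, h'⟩ | ⟨h, h'⟩ | ⟨h, h'⟩ | ⟨h, h'⟩ <;>
      simp [braidCoef, h']
  exists_pairType i j hij := by
    have := hpair i j hij
    have hs := hsymm i j
    have hi := hnorm j i
    have hj := hnorm i j
    simp only [Set.mem_insert_iff, Set.mem_singleton_iff, Prod.mk.injEq] at this
    rcases this with ⟨h, h'⟩ | ⟨h, h'⟩ | ⟨h, h'⟩ | ⟨h, h'⟩ | ⟨h, h'⟩ | ⟨h, h'⟩ <;>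
      simp only [h, h'] at hs hi hj
    · exact ⟨2, .two (by simp [braidCoef, h']) (by simp [braidCoef, h])⟩
    · have hd : d i = d j := by omega
      exact ⟨3, .three (by rw [hd]) (by simp [braidCoef, h, h', hd, sq])⟩
    -- The normalisation fixes the `d`'s on a multiply laced pair; the explicit exponents `1, 3, 5`
    -- satisfy the pair relation only for these values.
    · have hj := hj (by norm_num)
      have hd : d i = 2 := by omega
      exact ⟨4, .four (by simp [braidCoef, h, h', hd, hj]; ring)⟩
    · have hi := hi (by norm_num)
      have hd : d j = 2 := by omega
      exact ⟨4, .four (by simp [braidCoef, h, h', hd, hi]; ring)⟩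
    · have hj := hj (by norm_num)
      have hd : d i = 3 := by omega
      exact ⟨6, .six (X ^ 4) (pow_mem X_mem_natPoly _)
        (by simp [braidCoef, h, h', hd, hj]; ring) (by simp [hd, hj]; ring)⟩
    · have hi := hi (by norm_num)
      have hd : d j = 3 := by omega
      exact ⟨6, .six (X ^ 4) (pow_mem X_mem_natPoly _)
        (by simp [braidCoef, h, h', hd, hi]; ring) (by simp [hd, hi]; ring)⟩

end DeformedCoefficients

/-! ### Duality between ℓ-weights and exponent vectors -/

section Evaluation

theorem dilate_mul (a b : ℂˣ) (x : RatFunc ℂ) : dilate (a * b) x = dilate a (dilate b x) := by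
  suffices dilate (a * b) = (dilate a).comp (dilate b) by rw [this]; rfl
  apply IsLocalization.ringHom_ext (nonZeroDivisors ℂ[X])
  ext x
  · simp only [RingHom.comp_apply, dilate_algebraMap, C_comp]
  · simp only [RingHom.comp_apply, dilate_algebraMap, X_comp, mul_comp, C_comp, Units.val_mul,
      C_mul]
    congr 1
    ring

theorem dilateUnits_mul (a b : ℂˣ) (x : (RatFunc ℂ)ˣ) :
    dilateUnits (a * b) x = dilateUnits a (dilateUnits b x) :=
  Units.ext (dilate_mul a b x)

/-- Dilation by one is idempotent and injective. -/
theorem dilateUnits_one (x : (RatFunc ℂ)ˣ) : dilateUnits 1 x = x := by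
  have h : dilateUnits 1 (dilateUnits 1 x) = dilateUnits 1 x := by
    rw [← dilateUnits_mul, one_mul]
  exact Units.map_injective (dilate 1).injective h

/-- The map `ϖ(u) ↦ ϖ(q u)` in additive notation. -/
def dilateEnd (q : ℂˣ) : AddMonoid.End (Additive (RatFunc ℂ)ˣ) :=
  MonoidHom.toAdditive (dilateUnits q)

/-- The multiplicative group of rational functions, written additively, as a module over `ℤ[X]`
on which `X` acts as `ϖ(u) ↦ ϖ(q u)`. -/
def dilateAction (q : ℂˣ) : ℤ[X] →+* AddMonoid.End (Additive (RatFunc ℂ)ˣ) :=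
  eval₂RingHom' (Int.castRingHom (AddMonoid.End (Additive (RatFunc ℂ)ˣ)))
    (dilateEnd q) fun n => Int.cast_commute n (dilateEnd q)

theorem dilateAction_one (q : ℂˣ) (x : Additive (RatFunc ℂ)ˣ) : dilateAction q 1 x = x := by
  rw [map_one]; rfl

theorem dilateAction_add (q : ℂˣ) (a b : ℤ[X]) (x : Additive (RatFunc ℂ)ˣ) :
    dilateAction q (a + b) x = dilateAction q a x + dilateAction q b x := by
  rw [map_add]; rfl

theorem dilateAction_mul (q : ℂˣ) (a b : ℤ[X]) (x : Additive (RatFunc ℂ)ˣ) :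
    dilateAction q (a * b) x = dilateAction q a (dilateAction q b x) := by
  rw [map_mul]; rfl

/-- The action on a fixed element, as a homomorphism. -/
def dilateActionOn (q : ℂˣ) (x : Additive (RatFunc ℂ)ˣ) : ℤ[X] →+ Additive (RatFunc ℂ)ˣ :=
  AddMonoidHom.mk' (fun a => dilateAction q a x) fun a b => dilateAction_add q a b x

theorem dilateActionOn_apply (q : ℂˣ) (x : Additive (RatFunc ℂ)ˣ) (a : ℤ[X]) :
    dilateActionOn q x a = dilateAction q a x := rfl

theorem dilateAction_X_pow (q : ℂˣ) (n : ℕ) (x : (RatFunc ℂ)ˣ) :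
    dilateAction q (X ^ n) (Additive.ofMul x) = Additive.ofMul (dilateUnits (q ^ n) x) := by
  induction n with
  | zero => rw [pow_zero, pow_zero, dilateAction_one, dilateUnits_one]
  | succ n ih =>
    have hX : dilateAction q X = dilateEnd q := by
      rw [dilateAction, eval₂RingHom'_apply, eval₂_X]
    rw [pow_succ', dilateAction_mul, ih, pow_succ', dilateUnits_mul, hX]
    rfl

theorem dilateAction_X (q : ℂˣ) (x : (RatFunc ℂ)ˣ) :
    dilateAction q X (Additive.ofMul x) = Additive.ofMul (dilateUnits q x) := by
  simpa using dilateAction_X_pow q 1 x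

/-- Polynomials with constant term one, as non-zero rational functions. -/
def polyUnits : Submonoid (RatFunc ℂ)ˣ where
  carrier := {x | ∃ p : ℂ[X], p.coeff 0 = 1 ∧ (x : RatFunc ℂ) = algebraMap ℂ[X] (RatFunc ℂ) p}
  one_mem' := ⟨1, by simp⟩
  mul_mem' := by
    rintro x y ⟨p, hp, hp'⟩ ⟨r, hr, hr'⟩
    exact ⟨p * r, by simp [mul_coeff_zero, hp, hr], by simp [hp', hr']⟩

theorem dilateUnits_mem_polyUnits (c : ℂˣ) {x : (RatFunc ℂ)ˣ} (hx : x ∈ polyUnits) :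
    dilateUnits c x ∈ polyUnits := by
  obtain ⟨p, hp, hp'⟩ := hx
  refine ⟨p.comp (C (c : ℂ) * X), ?_, ?_⟩
  · rw [coeff_zero_eq_eval_zero] at hp ⊢
    simpa [eval_comp] using hp
  · rw [← dilate_algebraMap, ← hp']
    rfl

theorem dilateAction_mem (q : ℂˣ) {a : ℤ[X]} (ha : a ∈ natPoly) {x : (RatFunc ℂ)ˣ}
    (hx : x ∈ polyUnits) :
    dilateAction q a (Additive.ofMul x) ∈ polyUnits.toAddSubmonoid := by
  obtain ⟨a, rfl⟩ := ha
  induction a using Polynomial.induction_on' with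
  | add a b ha hb => rw [map_add, dilateAction_add]; exact add_mem ha hb
  | monomial n m =>
    have : mapRingHom (Nat.castRingHom ℤ) (monomial n m) = m • X ^ n := by
      simp [← C_mul_X_pow_eq_monomial]
    rw [← dilateActionOn_apply, this, map_nsmul, dilateActionOn_apply,
      dilateAction_X_pow]
    exact AddSubmonoid.nsmul_mem polyUnits.toAddSubmonoid (x := Additive.ofMul _)
      (dilateUnits_mem_polyUnits (q ^ n) hx) m

variable {I : Type*} [Fintype I]

/-- The pairing of a vector of exponents with a tuple of rational functions. -/
def pairTuple (q : ℂˣ) (v : I → ℤ[X]) (ϖ : I → (RatFunc ℂ)ˣ) : Additive (RatFunc ℂ)ˣ :=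
  ∑ j, dilateAction q (v j) (Additive.ofMul (ϖ j))

theorem pairTuple_mem (q : ℂˣ) {v : I → ℤ[X]} (hv : ∀ j, v j ∈ natPoly) {ϖ : I → (RatFunc ℂ)ˣ}
    (hϖ : ∀ j, ϖ j ∈ polyUnits) : pairTuple q v ϖ ∈ polyUnits.toAddSubmonoid :=
  sum_mem fun j _ => dilateAction_mem q (hv j) (hϖ j)

variable [DecidableEq I]

theorem pairTuple_single (q : ℂˣ) (i : I) (ϖ : I → (RatFunc ℂ)ˣ) :
    pairTuple q (Pi.single i 1) ϖ = Additive.ofMul (ϖ i) := by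
  rw [pairTuple, Finset.sum_eq_single i]
  · rw [Pi.single_eq_same, dilateAction_one]
  · intro j _ hj
    rw [Pi.single_eq_of_ne hj, map_zero]; rfl
  · simp

omit [Fintype I] in
theorem ofMul_braidHom (A : Matrix I I ℤ) (d : I → ℕ) (q : ℂˣ) (c : DeformedCartan I)
    (hp : ∀ i, c.p i = (X ^ d i) ^ 2) (hD : c.D = braidCoef A d) (i : I) (ϖ : I → (RatFunc ℂ)ˣ)
    (j : I) : Additive.ofMul (braidHom A d q i ϖ j) =
      Additive.ofMul (ϖ j) + dilateAction q (c.coef i j) (Additive.ofMul (ϖ i)) := by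
  change Additive.ofMul (braidFun A d q i ϖ j) = _
  unfold braidFun DeformedCartan.coef
  rcases eq_or_ne j i with rfl | hj
  · rw [if_pos rfl, if_pos rfl, hp, ← dilateActionOn_apply, map_sub, map_neg, ← pow_mul, ← pow_mul,
      dilateActionOn_apply, dilateActionOn_apply, dilateAction_X_pow, dilateAction_one, ofMul_inv]
    abel
  · rw [if_neg hj, if_neg hj.symm, hD, braidCoef]
    split_ifs
    · rw [dilateAction_X_pow]; rfl
    · rw [dilateAction_add, dilateAction_X_pow, dilateAction_X, ← add_assoc]; rfl
    · rw [dilateAction_add, dilateAction_add, dilateAction_X_pow,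
        dilateAction_X_pow, dilateAction_X, ← add_assoc, ← add_assoc]; rfl
    · rw [map_zero]; exact (add_zero _).symm

/-- Adjointness of `T̃_i` and `gen i`: both are governed by the same coefficients `coef i j`. -/
theorem pairTuple_braidHom (A : Matrix I I ℤ) (d : I → ℕ) (q : ℂˣ) (c : DeformedCartan I)
    (hp : ∀ i, c.p i = (X ^ d i) ^ 2) (hD : c.D = braidCoef A d) (i : I) (v : I → ℤ[X])
    (ϖ : I → (RatFunc ℂ)ˣ) :
    pairTuple q v (braidHom A d q i ϖ) = pairTuple q (c.gen i v) ϖ := by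
  have h1 : ∀ v v', pairTuple q (v + v') ϖ = pairTuple q v ϖ + pairTuple q v' ϖ := by
    intro v v'
    simp only [pairTuple, Pi.add_apply, dilateAction_add, Finset.sum_add_distrib]
  have h2 : ∀ a : ℤ[X], pairTuple q (a • Pi.single i 1) ϖ =
      dilateAction q a (Additive.ofMul (ϖ i)) := by
    intro a
    rw [← pairTuple_single q, pairTuple, pairTuple, map_sum]
    simp only [Pi.smul_apply, smul_eq_mul, dilateAction_mul]
  rw [c.gen_apply, h1, h2, DeformedCartan.functional, Fintype.linearCombination_apply,
    ← dilateActionOn_apply, map_sum]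
  simp only [pairTuple, dilateActionOn_apply]
  rw [← Finset.sum_add_distrib]
  refine Finset.sum_congr rfl fun j _ => ?_
  rw [ofMul_braidHom A d q c hp hD, map_add, smul_eq_mul, dilateAction_mul]

/-- Adjoints compose in the opposite order, hence the reversed word. With `v` a basis vector this
computes a single coordinate. -/
theorem pairTuple_braidWord (A : Matrix I I ℤ) (d : I → ℕ) (q : ℂˣ) (c : DeformedCartan I)
    (hp : ∀ i, c.p i = (X ^ d i) ^ 2) (hD : c.D = braidCoef A d) (l : List I) (v : I → ℤ[X])
    (ϖ : ellWeights I) :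
    pairTuple q v (braidWord A d q l ϖ : ellWeights I) =
      pairTuple q (c.word l.reverse v) (ϖ : I → (RatFunc ℂ)ˣ) := by
  induction l generalizing v with
  | nil => rfl
  | cons i l ih =>
    have h : ((braidWord A d q (i :: l) ϖ : ellWeights I) : I → (RatFunc ℂ)ˣ) =
        braidHom A d q i (braidWord A d q l ϖ : ellWeights I) := by
      rw [braidWord, List.map_cons, List.prod_cons]; rfl
    rw [h, pairTuple_braidHom A d q c hp hD, ih, List.reverse_cons, c.word_append,
      c.word_singleton, Module.End.mul_apply]

end Evaluation

/-! ### Lowering by a single `T̃_i` -/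

section Order

/-- The constant term excludes the root zero, so a factor `X - r` can be rescaled to `1 - r⁻¹ X`,
the constant `-r` being absorbed into the cofactor. -/
theorem exists_multiset_of_coeff_zero_eq_one (n : ℕ) : ∀ p : ℂ[X], p.natDegree = n →
    p.coeff 0 = 1 → ∃ s : Multiset ℂˣ, p = (s.map fun a : ℂˣ => 1 - C (a : ℂ) * X).prod := by
  induction n with
  | zero =>
    intro p hn hp
    exact ⟨0, by rw [eq_C_of_natDegree_eq_zero hn, hp]; simp⟩
  | succ n ih =>
    intro p hn hp
    obtain ⟨r, hr⟩ := IsAlgClosed.exists_root p (fun h => by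
      rw [natDegree_eq_of_degree_eq_some h] at hn; simp at hn)
    obtain ⟨g, rfl⟩ := dvd_iff_isRoot.mpr hr
    have hr0 : -r * g.coeff 0 = 1 := by simpa [mul_coeff_zero] using hp
    have hr : r ≠ 0 := by rintro rfl; simp at hr0
    have hg : g ≠ 0 := by rintro rfl; simp at hr0
    have hdeg : (C (-r) * g).natDegree = n := by
      rw [natDegree_C_mul (neg_ne_zero.mpr hr)]
      rw [natDegree_mul (X_sub_C_ne_zero r) hg, natDegree_X_sub_C] at hn
      omega
    obtain ⟨s, hs⟩ := ih _ hdeg (by rw [coeff_C_mul, hr0])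
    refine ⟨(Units.mk0 r hr)⁻¹ ::ₘ s, ?_⟩
    rw [Multiset.map_cons, Multiset.prod_cons, ← hs, ← mul_assoc]
    congr 1
    have : C r * C r⁻¹ = (1 : ℂ[X]) := by rw [← C_mul, mul_inv_cancel₀ hr, C_1]
    simp only [Units.val_inv_eq_inv_val, Units.val_mk0, C_neg]
    linear_combination (-X : ℂ[X]) * this

variable {I : Type*} [DecidableEq I] (A : Matrix I I ℤ) (d : I → ℕ) (q : ℂˣ)

theorem exists_ellRootsPos_of_mem_polyUnits (i : I) {x : (RatFunc ℂ)ˣ} (hx : x ∈ polyUnits) :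
    ∃ y : ellWeights I, (y : I → (RatFunc ℂ)ˣ) i = x ∧
      (braid A d q i y)⁻¹ * y ∈ ellRootsPos A d q := by
  obtain ⟨p, hp, hpx⟩ := hx
  obtain ⟨s, rfl⟩ := exists_multiset_of_coeff_zero_eq_one _ p rfl hp
  refine ⟨(s.map (fund i)).prod, ?_, ?_⟩
  · apply Units.ext
    rw [hpx]
    clear hpx hp
    induction s using Multiset.induction_on with
    | empty => simp
    | cons a s ih =>
      rw [Multiset.map_cons, Multiset.prod_cons, Multiset.map_cons, Multiset.prod_cons, map_mul,
        ← ih]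
      simp [fund, fundTuple]
  · clear hpx hp
    induction s using Multiset.induction_on with
    | empty => simp
    | cons a s ih =>
      rw [Multiset.map_cons, Multiset.prod_cons, map_mul, mul_inv, mul_mul_mul_comm]
      exact mul_mem (Submonoid.subset_closure ⟨i, a, rfl⟩) ih

theorem braid_eq_self {i : I} {z : ellWeights I} (hz : (z : I → (RatFunc ℂ)ˣ) i = 1) :
    braid A d q i z = z := by
  apply Subtype.ext
  funext j
  change braidFun A d q i z j = _
  unfold braidFun
  rw [hz]
  split_ifs with h
  · rw [h, hz]; simp
  all_goals simp

/-- Let `y` be the product of `π_{i,a}` with the same `i`-th coordinate as `ϖ`. Then `ϖ y⁻¹` is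
fixed by `T̃_i`, so `ϖ` and `y` are changed by the same factor. -/
theorem ellLE_braid {i : I} {ϖ : ellWeights I} (h : (ϖ : I → (RatFunc ℂ)ˣ) i ∈ polyUnits) :
    ellLE A d q (braid A d q i ϖ) ϖ := by
  obtain ⟨y, hy, hm⟩ := exists_ellRootsPos_of_mem_polyUnits A d q i h
  have hz := braid_eq_self A d q (i := i) (z := ϖ * y⁻¹) (by simp [hy])
  rw [map_mul, map_inv] at hz
  refine ⟨_, ⟨_, hm, rfl⟩, ?_⟩
  rw [mul_inv_eq_iff_eq_mul] at hz
  rw [hz, coe_invMonoidHom, mul_inv, inv_inv]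
  ac_rfl

theorem ellLE_refl (ϖ : ellWeights I) : ellLE A d q ϖ ϖ := ⟨1, one_mem _, (mul_one _).symm⟩

variable {A d q} in
theorem ellLE.trans {x y z : ellWeights I} (h : ellLE A d q x y) (h' : ellLE A d q y z) :
    ellLE A d q x z := by
  obtain ⟨β, hβ, rfl⟩ := h
  obtain ⟨γ, hγ, rfl⟩ := h'
  exact ⟨γ * β, mul_mem hγ hβ, mul_assoc _ _ _⟩

end Order

/-! ### Lowering along a reduced word -/

namespace HeightSystem

variable {I G : Type*} [Group G] {c : DeformedCartan I} {H : HeightSystem c G}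

theorem prod_reverse (l : List I) : H.prod l.reverse = (H.prod l)⁻¹ := by
  induction l with
  | nil => simp [prod]
  | cons i l ih =>
    have h : H.prod (i :: l) = H.s i * H.prod l := by simp [prod]
    rw [List.reverse_cons, prod_append, prod_singleton, ih, h, mul_inv_rev,
      inv_eq_of_mul_eq_one_left (H.s_mul_self i)]

/-- The braid group operators lower dominant ℓ-weights along reversed reduced words. -/
theorem IsReduced.ellLE_braidWord [Fintype I] [DecidableEq I] (A : Matrix I I ℤ) (d : I → ℕ)
    (q : ℂˣ) (hp : ∀ i, c.p i = (X ^ d i) ^ 2) (hD : c.D = braidCoef A d) (l : List I)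
    (hl : H.IsReduced l.reverse) {π : ellWeights I} (hπ : π ∈ dominant I) :
    ellLE A d q (braidWord A d q l π) π := by
  induction l with
  | nil => exact ellLE_refl A d q π
  | cons i l ih =>
    rw [List.reverse_cons] at hl
    refine ellLE.trans ?_ (ih hl.of_append)
    have h : braidWord A d q (i :: l) π = QAff.braid A d q i (braidWord A d q l π) := by
      rw [QAff.braidWord, List.map_cons, List.prod_cons]; rfl
    rw [h]
    apply ellLE_braid
    have hpos := hl.height_neg
    rw [prod_append, prod_singleton, h_mul_self, neg_lt_zero] at hpos
    have := pairTuple_mem q (ϖ := (π : I → (RatFunc ℂ)ˣ))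
      (IsReduced.word_single_mem _ _ i rfl hl.of_append hpos) hπ
    rwa [← pairTuple_braidWord A d q c hp hD, pairTuple_single] at this

end HeightSystem

/-! ### Passage to the dual root system -/

section Transfer

variable {ι k M N : Type*} [Field k] [AddCommGroup M] [Module k M]
  [AddCommGroup N] [Module k N] {R : RootPairing ι k M N} [R.IsRootSystem]
  [CharZero k] [Finite ι] [R.IsCrystallographic] [R.IsReduced]

/-- The height system of the dual root system. -/
def dualHeightSystem (b : R.Base) (c : DeformedCartan b.support)
    (hA : ∀ i j, c.A i j = R.pairingIn ℤ i j) : HeightSystem c R.flip.weylGroup :=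
  weylHeightSystem b.flip c fun i j => by
    apply FaithfulSMul.algebraMap_injective ℤ k
    rw [R.flip.algebraMap_pairingIn, R.pairing_flip]
    exact (congrArg _ (hA i j)).trans (R.algebraMap_pairingIn ℤ i j)

/-- Reduced expressions in the Weyl group of a root system, reversed, are reduced words for the
dual root system. -/
theorem IsReducedExpression.isReduced_reverse (b : R.Base)
    (c : DeformedCartan b.support)
    (hA : ∀ i j, c.A i j = R.pairingIn ℤ i j) {l : List b.support} {w : R.weylGroup}
    (hl : IsReducedExpression b l w) : (dualHeightSystem b c hA).IsReduced l.reverse := by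
  set H := dualHeightSystem b c hA
  -- The Weyl groups of `R` and of its dual induce the same permutations of the index set, and that
  -- of `R` acts faithfully there.
  have key : ∀ l : List b.support,
      R.flip.weylGroupToPerm (H.prod l) = R.weylGroupToPerm (simpleWord b l) := by
    intro l
    induction l with
    | nil =>
      have h1 : H.prod [] = 1 := rfl
      have h2 : simpleWord b [] = 1 := rfl
      rw [h1, h2, map_one, map_one]
    | cons i l ih =>
      have h1 : H.prod (i :: l) = RootPairing.weylGroup.ofIdx R.flip i * H.prod l := by
        rw [HeightSystem.prod, List.map_cons, List.prod_cons]; rfl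
      have h2 : simpleWord b (i :: l) = RootPairing.weylGroup.ofIdx R i * simpleWord b l := by
        simp [simpleWord]
      rw [h1, h2, map_mul, map_mul, ih, weylGroupToPerm_ofIdx, weylGroupToPerm_ofIdx]
      rfl
  intro l' hl'
  have h := hl.2 l'.reverse (by
    rw [← hl.1]
    apply weylGroupToPerm_injective
    rw [← key, ← key, HeightSystem.prod_reverse, hl', HeightSystem.prod_reverse, inv_inv])
  simpa using h

omit [R.IsRootSystem] in
-- Distinct simple roots are not opposite and pair non-positively, which leaves only these cases of
-- the crystallographic list.
theorem cartan_mem (b : R.Base) {i j : b.support} (hij : i ≠ j) :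
    (cartan b i j, cartan b j i) ∈
      ({(0, 0), (-1, -1), (-1, -2), (-2, -1), (-1, -3), (-3, -1)} : Set (ℤ × ℤ)) := by
  have hne : (i : ι) ≠ j := fun h => hij (Subtype.ext h)
  have h := R.pairingIn_pairingIn_mem_set_of_isCrystal_of_isRed' j i
    (fun h => hne (R.root.injective h).symm) (b.root_ne_neg_of_ne j.2 i.2 hne.symm)
  have h1 := b.pairingIn_le_zero_of_ne hne i.2 j.2
  change (R.pairingIn ℤ j i, R.pairingIn ℤ i j) ∈ _
  simp only [Set.mem_insert_iff, Set.mem_singleton_iff, Prod.mk.injEq] at h ⊢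
  omega

end Transfer

end QAff

end

theorem mainTheorem2 {ι k M N : Type*} [Finite ι] [DecidableEq ι] [Field k] [CharZero k]
    [AddCommGroup M] [Module k M] [AddCommGroup N] [Module k N]
    (R : RootPairing ι k M N) [R.IsRootSystem] [R.IsCrystallographic] [R.IsReduced]
    [R.IsIrreducible] (b : R.Base)
    (d : b.support → ℕ) (hd_pos : ∀ i, 0 < d i)
    (hd_symm : ∀ i j, (d i : ℤ) * QAff.cartan b i j = (d j : ℤ) * QAff.cartan b j i)
    (hd_norm : ∀ i j, QAff.cartan b j i < -1 → d j = 1)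
    (q : ℂˣ) (hq : ∀ m : ℕ, 0 < m → q ^ m ≠ 1)
    (π : QAff.ellWeights b.support) (hπ : π ∈ QAff.dominant b.support)
    (w : R.weylGroup) (l : List b.support) (hl : QAff.IsReducedExpression b l w) :
    QAff.ellLE (QAff.cartan b) d q (QAff.braidWord (QAff.cartan b) d q l π) π := by
  let c : QAff.DeformedCartan b.support :=
    QAff.braidDeformation (QAff.cartan b) d (fun i => b.cartanMatrix_apply_same i)
      (fun i j hij => QAff.cartan_mem b hij) hd_symm hd_norm
  exact (hl.isReduced_reverse b c fun _ _ => rfl).ellLE_braidWord (QAff.cartan b) d q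
    (fun _ => rfl) rfl l hπ
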